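/- **Conventions.** For a number field $F$ of degree $n$ with ring of integers $O_F$, let $\Sigma_F\colon F\to\mathbb C^{n}$, $a\mapsto(\sigma(a))_\sigma$, be the canonical embedding, where $\sigma$ runs over all $n$ embeddings of $F$ into $\mathbb C$ and $\mathbb C^n$ carries the Euclidean norm $\|\cdot\|$. A nonzero ideal $I\subseteq O_F$ is identified with the lattice $\Sigma_F(I)$, of rank $n$. The determinant $\det(\Lambda)$ of a lattice $\Lambda$ is its covolume in the real subspace that it spans. For a lattice $\Lambda$ of rank $n$ and a real number $\gamma$, a *solution to Hermite-SVP with factor $\gamma$ in $\Lambda$* is a nonzero $v\in\Lambda$ with $\|v\|\le\gamma\cdot\det(\Lambda)^{1/n}$; for $\gamma=\sqrt n$ one says that $v$ *satisfies the Minkowski bound*. For an extension $L/K$ of number fields, $\mathrm{disc}(L/K)$ is the ideal of $O_K$ generated by the discriminants $\det(\sigma_i b_j)^2$ of all $K$-bases $(b_j)$ of $L$ contained in $O_L$, where the $\sigma_i$ are the embeddings of $L$ over $K$; $N_K(I)=|O_K/I|$ is the norm of a nonzero ideal $I$ of $O_K$. **Theorem.** Let $L/\mathbb Q$ be a finite Galois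 extension of degree $N$, let $\mathfrak p$ be a prime ideal of $O_L$ lying over a rational prime $p$ that is unramified in $L$, and let $g$ be the number of distinct prime ideal factors of $pO_L$. Let $K=\{x\in L:\sigma(x)=x\text{ for all }\sigma\in\mathrm{Gal}(L/\mathbb Q)\text{ with }\sigma(\mathfrak p)=\mathfrak p\}$ be the decomposition field of $\mathfrak p$, and let $\mathfrak c=\mathfrak p\cap O_K$. 1. For every real $\gamma$ and every $x\in K$: if $\Sigma_K(x)$ is a solution to Hermite-SVP with factor $\gamma$ in $\mathfrak c$ (under the canonical embedding of $K$), then $\Sigma_L(x)$ is a solution to Hermite-SVP in $\mathfrak p$ (under the canonical embedding of $L$) with factor $$\frac{\sqrt{N/g}}{N_K(\mathrm{disc}(L/K))^{1/(2N)}}\cdot\gamma .$$ 2. For $\gamma\ge 0$ this factor is at most $\sqrt{N/g}\cdot\gamma$. 3. In particular, for $\gamma=\sqrt g$ the Minkowski bound is preserved: for $x\in K$, $\Sigma_K(x)$ is a solution to Hermite-SVP with factor $\sqrt g$ in $\mathfrak c$ if and only if it satisfies the Minkowski bound in $\mathfrak c$, and in that case $\Sigma_L(x)$ satisfies the Minkowski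 bound in $\mathfrak p$. -/

import Mathlib

open NumberField Module
open scoped Pointwise

noncomputable section

/-- The determinant of a lattice `Λ` in a Euclidean space `E` (not necessarily of full rank): the
covolume of `Λ` in the real subspace spanned by `Λ`. -/
def latticeDet {E : Type*} [NormedAddCommGroup E] [InnerProductSpace ℝ E] [FiniteDimensional ℝ E]
    [MeasurableSpace E] [BorelSpace E] (Λ : Submodule ℤ E) : ℝ :=
  ZLattice.covolume (ZLattice.comap ℝ Λ (Submodule.span ℝ (Λ : Set E)).subtype)
    MeasureTheory.volume

/-- The vector `v` is a solution to Hermite-SVP with factor `γ` in the lattice `Λ`: it is a nonzero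
vector of `Λ` of norm at most `γ * det(Λ) ^ (1 / n)`, where `n` is the rank of `Λ`. -/
def IsHermiteSVPSolution {E : Type*} [NormedAddCommGroup E] [InnerProductSpace ℝ E]
    [FiniteDimensional ℝ E] [MeasurableSpace E] [BorelSpace E]
    (Λ : Submodule ℤ E) (γ : ℝ) (v : E) : Prop :=
  v ∈ Λ ∧ v ≠ 0 ∧ ‖v‖ ≤ γ * latticeDet Λ ^ (1 / (finrank ℤ Λ : ℝ))

/-- A nonzero vector of the lattice `Λ` satisfies the Minkowski bound when its norm is at most
`√n * det(Λ) ^ (1 / n)`, where `n` is the rank of `Λ`. -/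
def SatisfiesMinkowskiBound {E : Type*} [NormedAddCommGroup E] [InnerProductSpace ℝ E]
    [FiniteDimensional ℝ E] [MeasurableSpace E] [BorelSpace E]
    (Λ : Submodule ℤ E) (v : E) : Prop :=
  v ∈ Λ ∧ v ≠ 0 ∧
    ‖v‖ ≤ Real.sqrt (finrank ℤ Λ : ℝ) * latticeDet Λ ^ (1 / (finrank ℤ Λ : ℝ))

/-- The canonical embedding `a ↦ (σ a)_σ` of a number field `K` into `ℂ ^ [K : ℚ]`, where `σ` runs
over all embeddings of `K` into `ℂ`, with the Euclidean norm on the target. -/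
def canonEmb (K : Type*) [Field K] [NumberField K] : K →+ EuclideanSpace ℂ (K →+* ℂ) where
  toFun a := WithLp.toLp 2 (canonicalEmbedding K a)
  map_zero' := by simp
  map_add' a b := by simp

/-- The ideal lattice of an ideal `I` of `𝓞 K`: its image under the canonical embedding. -/
def idealLattice (K : Type*) [Field K] [NumberField K] (I : Ideal (𝓞 K)) :
    Submodule ℤ (EuclideanSpace ℂ (K →+* ℂ)) :=
  AddSubgroup.toIntSubmodule
    (I.toAddSubgroup.map ((canonEmb K).comp (algebraMap (𝓞 K) K).toAddMonoidHom))

/-- The relative discriminant `disc(L/K)`: the ideal of `𝓞 K` generated by the discriminants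
`det (σᵢ bⱼ) ^ 2` of all `K`-bases `b` of `L` that are contained in `𝓞 L`. -/
def relDisc (K L : Type*) [Field K] [NumberField K] [Field L] [NumberField L] [Algebra K L] :
    Ideal (𝓞 K) :=
  Ideal.span {d : 𝓞 K | ∃ b : Basis (Fin (finrank K L)) K L,
    (∀ i, IsIntegral ℤ (b i)) ∧ algebraMap (𝓞 K) K d = Algebra.discr K b}

/-- The decomposition field of an ideal `P` of `𝓞 L`: the subfield of `L` fixed by the group of all
`σ` in the Galois group of `L/ℚ` with `σ(P) = P`. -/
def decompField (L : Type*) [Field L] [NumberField L] (P : Ideal (𝓞 L)) : IntermediateField ℚ L :=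
  IntermediateField.fixedField (MulAction.stabilizer Gal(L/ℚ) P)

end

/-! Write c for the prime of K below P. Passing from K to L multiplies the length of x by √[L : K],
since each embedding of K has [L : K] extensions to L. On the other side, an ideal lattice has
determinant √|disc| · N(I).

Galois theory gives [K : ℚ] = g. As P is the only prime over c and is unramified, its residue degree
over c is [L : K], so N(P) = N(c)^[L : K]. The tower formula |disc L| = N(different) · |disc K|^[L :
K] then compares the two determinants; `isHermiteSVPSolution_algebraMap` combines this with the
length.

It remains to bound N(different) below by N(disc(L/K)). The inclusion of the relative norm of the
different in disc(L/K) suffices; it is checked at each maximal ideal of `𝓞 K` using a local basis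
(`pow_mul_intNorm_mem_relDisc`). -/

/-- The squared determinant of the lattice spanned by linearly independent vectors is their Gram
determinant. -/
theorem latticeDet_span_sq {E : Type*} [NormedAddCommGroup E] [InnerProductSpace ℝ E]
    [FiniteDimensional ℝ E] [MeasurableSpace E] [BorelSpace E] {ι : Type*} [Fintype ι]
    [DecidableEq ι] {v : ι → E} (hv : LinearIndependent ℝ v) :
    latticeDet (Submodule.span ℤ (Set.range v)) ^ 2 = (Matrix.gram ℝ v).det := by
  set Λ := Submodule.span ℤ (Set.range v) with hΛ
  have hspan : Submodule.span ℝ (Λ : Set E) = Submodule.span ℝ (Set.range v) :=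
    Submodule.span_span_of_tower ℤ ℝ _
  set V := Submodule.span ℝ (Λ : Set E)
  let b : Basis ι ℝ V := (Basis.span hv).map (LinearEquiv.ofEq _ _ hspan.symm)
  have hb (i : ι) : (b i : E) = v i := by simp [b, Basis.span_apply]
  have hcomap : ZLattice.comap ℝ Λ V.subtype = Submodule.span ℤ (Set.range b) := by
    apply Submodule.map_injective_of_injective (f := V.subtype.restrictScalars ℤ)
      V.injective_subtype
    rw [Submodule.map_span, ← Set.range_comp,
      show ((V.subtype.restrictScalars ℤ) ∘ b) = v from funext hb, ← hΛ]
    refine (Submodule.map_comap_eq _ _).trans (inf_eq_right.mpr ?_)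
    intro x hx
    exact ⟨⟨x, Submodule.subset_span hx⟩, rfl⟩
  let e : Fin (finrank ℝ V) ≃ ι := Fintype.equivOfCardEq (by
    rw [Fintype.card_fin, finrank_eq_card_basis b])
  let b₀ : OrthonormalBasis ι ℝ V := (stdOrthonormalBasis ℝ V).reindex e
  -- An orthonormal cell has volume 1, so the covolume is |det| of `b` in orthonormal coordinates;
  -- the Gram matrix is this coordinate matrix times its transpose.
  have hvol : (MeasureTheory.volume : MeasureTheory.Measure V).real
      (ZSpan.fundamentalDomain b₀.toBasis) = 1 := by
    rw [MeasureTheory.measureReal_congr (ZSpan.fundamentalDomain_ae_parallelepiped _ _)]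
    simp [MeasureTheory.measureReal_def, b₀.volume_parallelepiped]
  have hdet : latticeDet Λ = |b₀.toBasis.det b| := by
    rw [latticeDet, hcomap, ZLattice.covolume_eq_measure_fundamentalDomain _ _
      (ZSpan.isAddFundamentalDomain b _), ZSpan.measureReal_fundamentalDomain b _ b₀.toBasis,
      hvol, mul_one]
  rw [hdet, sq_abs, sq, Basis.det_apply]
  nth_rw 1 [← Matrix.det_transpose]
  rw [← Matrix.det_mul]
  congr 1
  ext i j
  simp only [Matrix.mul_apply, Matrix.transpose_apply, Basis.toMatrix_apply,
    OrthonormalBasis.coe_toBasis_repr_apply, b₀.repr_apply_apply, Matrix.gram_apply]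
  rw [← hb i, ← hb j, ← Submodule.coe_inner, ← b₀.sum_inner_mul_inner]
  exact Finset.sum_congr rfl fun k _ ↦ by rw [real_inner_comm]

theorem latticeDet_nonneg {E : Type*} [NormedAddCommGroup E] [InnerProductSpace ℝ E]
    [FiniteDimensional ℝ E] [MeasurableSpace E] [BorelSpace E] (Λ : Submodule ℤ E) :
    0 ≤ latticeDet Λ :=
  ENNReal.toReal_nonneg

/-! ### Determinant and rank of ideal lattices -/

section IdealLattice

variable {K : Type*} [Field K] [NumberField K]

@[simp]
theorem canonEmb_apply (x : K) (σ : K →+* ℂ) : canonEmb K x σ = σ x := rfl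

theorem norm_canonEmb_sq (x : K) : ‖canonEmb K x‖ ^ 2 = ∑ σ : K →+* ℂ, ‖σ x‖ ^ 2 := by
  simp [EuclideanSpace.norm_sq_eq]

theorem canonEmb_injective : Function.Injective (canonEmb K) := fun _ _ h ↦
  canonicalEmbedding_injective K ((WithLp.toLp_injective 2) h)

theorem canonEmb_mem_idealLattice {I : Ideal (𝓞 K)} {x : K} :
    canonEmb K x ∈ idealLattice K I ↔ ∃ y ∈ I, (y : K) = x := by
  constructor
  · rintro ⟨y, hy, h⟩
    exact ⟨y, hy, canonEmb_injective h⟩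
  · rintro ⟨y, hy, rfl⟩
    exact ⟨y, hy, rfl⟩

/-- The sum is real because complex conjugation permutes the embeddings. -/
theorem inner_canonEmb (x y : K) :
    ((inner ℝ (canonEmb K x) (canonEmb K y) : ℝ) : ℂ) =
      ∑ σ : K →+* ℂ, σ x * starRingEnd ℂ (σ y) := by
  have h : inner ℝ (canonEmb K x) (canonEmb K y) =
      (∑ σ : K →+* ℂ, σ x * starRingEnd ℂ (σ y)).re := by
    rw [PiLp.inner_apply, Complex.re_sum]
    exact Finset.sum_congr rfl fun σ _ ↦ by simp [Complex.inner]; ring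
  rw [h]
  refine Complex.conj_eq_iff_re.mp ?_
  rw [map_sum]
  let e : (K →+* ℂ) ≃ (K →+* ℂ) :=
    (NumberField.ComplexEmbedding.involutive_conjugate K).toPerm
  rw [← e.sum_comp]
  refine Finset.sum_congr rfl fun σ _ ↦ ?_
  simp [e, ComplexEmbedding.conjugate_coe_eq]

/-- An ideal lattice is spanned by linearly independent vectors with Gram determinant
`|disc(K)| * N(I) ^ 2`. -/
theorem exists_basis_idealLattice {I : Ideal (𝓞 K)} (hI : I ≠ ⊥) :
    ∃ v : Free.ChooseBasisIndex ℤ (𝓞 K) → EuclideanSpace ℂ (K →+* ℂ), LinearIndependent ℝ v ∧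
      idealLattice K I = Submodule.span ℤ (Set.range v) ∧
      (Matrix.gram ℝ v).det = |(discr K : ℝ)| * (Ideal.absNorm I : ℝ) ^ 2 := by
  classical
  let bO := RingOfIntegers.basis K
  let bI := Ideal.selfBasis bO I hI
  let v i : EuclideanSpace ℂ (K →+* ℂ) := canonEmb K ((bI i : 𝓞 K) : K)
  have hcard : Fintype.card (Free.ChooseBasisIndex ℤ (𝓞 K)) = Fintype.card (K →ₐ[ℚ] ℂ) := by
    rw [AlgHom.card, ← RingOfIntegers.rank, finrank_eq_card_basis bO]
  let e : Free.ChooseBasisIndex ℤ (𝓞 K) ≃ (K →ₐ[ℚ] ℂ) := Fintype.equivOfCardEq hcard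
  let MO := Algebra.embeddingsMatrixReindex ℚ ℂ (integralBasis K) e
  let M := Algebra.embeddingsMatrixReindex ℚ ℂ (fun i ↦ ((bI i : 𝓞 K) : K)) e
  have hM (i j) : M i j = e j ((bI i : 𝓞 K) : K) := rfl
  have hMO (i j) : MO i j = e j ((bO i : 𝓞 K) : K) := by
    change e j (integralBasis K i) = _
    rw [integralBasis_apply]
  let T := bO.toMatrix (fun i ↦ (bI i : 𝓞 K))
  -- `MO` carries the discriminant of K and `T`, the change of basis from `𝓞 K` to `I`, carries the
  -- index N(I).
  have hMT : M = (T.map (Int.castRingHom ℂ)).transpose * MO := by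
    ext i j
    rw [hM, ← bO.sum_repr (bI i : 𝓞 K)]
    simp [Matrix.mul_apply, T, Basis.toMatrix_apply, hMO]
  have hMOdet : MO.det ^ 2 = (discr K : ℂ) := by
    rw [← Algebra.discr_eq_det_embeddingsMatrixReindex_pow_two, ← coe_discr]
    simp
  have hTdet : |(T.det : ℝ)| = Ideal.absNorm I := by
    rw [← Ideal.natAbs_det_basis_change bO I bI, Nat.cast_natAbs, Int.cast_abs]
    rfl
  have hMdet : ‖M.det‖ ^ 2 = |(discr K : ℝ)| * (Ideal.absNorm I : ℝ) ^ 2 := by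
    have : ((T.map (Int.castRingHom ℂ)).det : ℂ) = T.det := by
      rw [← RingHom.mapMatrix_apply, ← RingHom.map_det]; simp
    rw [hMT, Matrix.det_mul, Matrix.det_transpose, this, ← norm_pow, mul_pow, hMOdet, norm_mul,
      norm_pow, Complex.norm_intCast, Complex.norm_intCast, hTdet, mul_comm]
  have hM0 : M.det ≠ 0 := by
    rw [← norm_ne_zero_iff, ← sq_pos_iff, hMdet]
    have := discr_ne_zero K
    have := Ideal.absNorm_eq_zero_iff.not.mpr hI
    positivity
  have hgram : (Matrix.gram ℝ v).map Complex.ofRealHom = M * M.conjTranspose := by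
    ext i j
    rw [Matrix.map_apply, Matrix.gram_apply, Complex.ofRealHom_eq_coe, inner_canonEmb,
      Matrix.mul_apply]
    rw [← ((e.trans (RingHom.equivRatAlgHom K ℂ).symm)).sum_comp]
    rfl
  refine ⟨v, ?_, ?_, ?_⟩
  · have h := (Matrix.linearIndependent_rows_of_det_ne_zero hM0).restrict_scalars (R := ℝ)
      (fun r s h ↦ by simpa using h)
    let f : EuclideanSpace ℂ (K →+* ℂ) →ₗ[ℝ] (Free.ChooseBasisIndex ℤ (𝓞 K) → ℂ) :=
      { toFun x i := x (e i : K →+* ℂ)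
        map_add' _ _ := rfl
        map_smul' _ _ := rfl }
    exact LinearIndependent.of_comp f h
  · apply le_antisymm
    · rintro _ ⟨y, hy, rfl⟩
      let f : I →+ EuclideanSpace ℂ (K →+* ℂ) :=
        ((canonEmb K).comp (algebraMap (𝓞 K) K).toAddMonoidHom).comp (I.subtype.toAddMonoidHom)
      have : f ⟨y, hy⟩ ∈ Submodule.span ℤ (Set.range v) := by
        rw [← bI.sum_repr ⟨y, hy⟩, map_sum]
        refine Submodule.sum_mem _ fun i _ ↦ ?_
        rw [map_zsmul]
        exact Submodule.smul_mem _ _ (Submodule.subset_span ⟨i, rfl⟩)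
      exact this
    · rw [Submodule.span_le]
      rintro _ ⟨i, rfl⟩
      exact ⟨_, (bI i).2, rfl⟩
  · rw [← hMdet, ← Complex.ofReal_inj, ← Complex.ofRealHom_eq_coe, RingHom.map_det,
      RingHom.mapMatrix_apply, hgram, Matrix.det_mul, Matrix.det_conjTranspose]
    simpa using Complex.mul_conj' M.det

theorem latticeDet_idealLattice_sq {I : Ideal (𝓞 K)} (hI : I ≠ ⊥) :
    latticeDet (idealLattice K I) ^ 2 = |(discr K : ℝ)| * (Ideal.absNorm I : ℝ) ^ 2 := by
  classical
  obtain ⟨v, hv, hspan, hgram⟩ := exists_basis_idealLattice hI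
  rw [hspan, latticeDet_span_sq hv, hgram]

theorem finrank_idealLattice {I : Ideal (𝓞 K)} (hI : I ≠ ⊥) :
    finrank ℤ (idealLattice K I) = finrank ℚ K := by
  classical
  obtain ⟨v, hv, hspan, -⟩ := exists_basis_idealLattice hI
  have hv' : LinearIndependent ℤ v := hv.restrict_scalars (fun r s h ↦ by simpa using h)
  rw [hspan, finrank_span_eq_card hv', ← RingOfIntegers.rank,
    finrank_eq_card_basis (RingOfIntegers.basis K)]

end IdealLattice

/-- Passing to an extension of degree `[L : K]` multiplies the length of the canonical embedding
of an element of `K` by `√[L : K]`. -/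
theorem norm_canonEmb_algebraMap_sq (K L : Type*) [Field K] [NumberField K] [Field L]
    [NumberField L] [Algebra K L] (x : K) :
    ‖canonEmb L (algebraMap K L x)‖ ^ 2 = finrank K L * ‖canonEmb K x‖ ^ 2 := by
  classical
  rw [norm_canonEmb_sq, norm_canonEmb_sq,
    ← (RingHom.equivRatAlgHom L ℂ).symm.sum_comp, ← (RingHom.equivRatAlgHom K ℂ).symm.sum_comp,
    -- Embeddings of L are grouped by their restriction to K.
    ← (algHomEquivSigma (A := ℚ) (B := K) (C := L) (D := ℂ)).symm.sum_comp, Finset.mul_sum]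
  rw [Fintype.sum_sigma]
  refine Finset.sum_congr rfl fun σ _ ↦ ?_
  let := σ.toRingHom.toAlgebra
  have h (τ : L →ₐ[K] ℂ) : τ (algebraMap K L x) = σ x := τ.commutes x
  trans ∑ τ : L →ₐ[K] ℂ, ‖τ (algebraMap K L x)‖ ^ 2
  · rfl
  rw [Finset.sum_congr rfl fun τ _ ↦ by rw [h τ], Finset.sum_const, nsmul_eq_mul, Finset.card_univ,
    AlgHom.card]
  rfl

/-! ### Relative discriminant and different -/

section RelDisc

variable (K L : Type*) [Field K] [NumberField K] [Field L] [NumberField L] [Algebra K L]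

set_option linter.deprecated false in
/-- At a maximal ideal `q` of `𝓞 K`, the ring `𝓞 L` has a local basis over `𝓞 K`. -/
theorem exists_basis_smul_mem_span (q : Ideal (𝓞 K)) [q.IsMaximal] :
    ∃ (b : Basis (Fin (finrank K L)) K L) (s : 𝓞 K), s ∉ q ∧ (∀ i, IsIntegral ℤ (b i)) ∧
      ∀ y : 𝓞 L, algebraMap (𝓞 K) L s * (y : L) ∈ Submodule.span (𝓞 K) (Set.range b) := by
  let := Ideal.Quotient.field q
  have hfin : Module.Finite (𝓞 K ⧸ q) (𝓞 L ⧸ q.map (algebraMap (𝓞 K) (𝓞 L))) :=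
    Module.Finite.of_restrictScalars_finite (𝓞 K) _ _
  let c := finBasisOfFinrankEq (𝓞 K ⧸ q) _ (Ideal.finrank_quotient_map (S := 𝓞 L) q K L)
  choose c' hc' using fun i ↦ Ideal.Quotient.mk_surjective (c i)
  let N := Submodule.span (𝓞 K) (Set.range c')
  -- Lifts of a basis of `𝓞 L / q` generate `𝓞 L` modulo `q`; Nakayama then yields s ≡ 1 mod `q`
  -- with s · `𝓞 L` inside their span.
  have hN : (⊤ : Submodule (𝓞 K) (𝓞 L)) ≤ N ⊔ q • ⊤ := by
    intro y _
    have hy := c.sum_repr (Ideal.Quotient.mk _ y)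
    choose a ha using fun i ↦ Ideal.Quotient.mk_surjective (c.repr (Ideal.Quotient.mk _ y) i)
    have : y - ∑ i, a i • c' i ∈ q • (⊤ : Submodule (𝓞 K) (𝓞 L)) := by
      rw [Ideal.smul_top_eq_map, Submodule.restrictScalars_mem, ← Ideal.Quotient.eq_zero_iff_mem,
        map_sub, sub_eq_zero]
      refine hy.symm.trans ?_
      rw [map_sum]
      refine Finset.sum_congr rfl fun i _ ↦ ?_
      rw [← ha i, ← hc' i, Algebra.smul_def, Algebra.smul_def, map_mul]
      rfl
    rw [← add_sub_cancel (∑ i, a i • c' i) y]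
    exact Submodule.add_mem_sup (Submodule.sum_mem _ fun i _ ↦
      Submodule.smul_mem _ _ (Submodule.subset_span ⟨i, rfl⟩)) this
  obtain ⟨s, hs, hsN⟩ := Submodule.exists_sub_one_mem_and_smul_le_of_fg_of_le_sup
    (Module.finite_def.mp inferInstance) le_rfl hN
  have hsq : s ∉ q := fun h ↦ (Ideal.ne_top_iff_one q).mp (Ideal.IsMaximal.ne_top ‹_›)
    (by simpa using q.sub_mem h hs)
  let c'' i : L := c' i
  have hspan (y : 𝓞 L) :
      algebraMap (𝓞 K) L s * (y : L) ∈ Submodule.span (𝓞 K) (Set.range c'') := by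
    have h : s • y ∈ N := hsN (Submodule.smul_mem_pointwise_smul _ _ _ Submodule.mem_top)
    have := Submodule.mem_map_of_mem (f := (IsScalarTower.toAlgHom (𝓞 K) (𝓞 L) L).toLinearMap) h
    rw [Submodule.map_span, ← Set.range_comp] at this
    rw [← Algebra.smul_def]
    convert! this using 1
    exact (map_smul (IsScalarTower.toAlgHom (𝓞 K) (𝓞 L) L).toLinearMap s y).symm
  have htop : ⊤ ≤ Submodule.span K (Set.range c'') := by
    intro x _
    obtain ⟨a, ha, hx⟩ := IsAlgebraic.exists_integral_multiple (R := 𝓞 K)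
      ((IsFractionRing.isAlgebraic_iff (𝓞 K) K L).mpr (Algebra.IsAlgebraic.isAlgebraic x))
    have hx' : IsIntegral ℤ (a • x) := isIntegral_trans _ hx
    have h := Submodule.span_le_restrictScalars (𝓞 K) K _ (hspan ⟨a • x, hx'⟩)
    rw [Submodule.restrictScalars_mem] at h
    have hsa : algebraMap (𝓞 K) K (s * a) ≠ 0 := by
      rw [Ne, FaithfulSMul.algebraMap_eq_zero_iff, mul_eq_zero, not_or]
      exact ⟨by rintro rfl; exact hsq q.zero_mem, ha⟩
    convert! Submodule.smul_mem _ (algebraMap (𝓞 K) K (s * a))⁻¹ h using 1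
    rw [eq_inv_smul_iff₀ hsa, Algebra.smul_def, ← IsScalarTower.algebraMap_apply, map_mul,
      mul_assoc, ← Algebra.smul_def a x]
    rfl
  let b := basisOfTopLeSpanOfCardEqFinrank c'' htop (by simp)
  have hb : ⇑b = c'' := coe_basisOfTopLeSpanOfCardEqFinrank _ _ _
  refine ⟨b, s, hsq, fun i ↦ ?_, ?_⟩
  · rw [hb]
    exact (c' i).2
  · rwa [hb]

variable {K L}

theorem repr_eq_trace_traceDual {ι : Type*} [Finite ι] [DecidableEq ι] (b : Basis ι K L) (z : L)
    (i : ι) : b.repr z i = Algebra.trace K L (z * b.traceDual i) := by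
  conv_lhs => rw [← b.traceDual_traceDual]
  rw [Basis.traceDual_repr_apply, Algebra.traceForm_apply]

/-- If `s` multiplies `𝓞 L` into the lattice spanned by an integral basis `b`, then `s ^ (2n)`
multiplies norms of elements of the different into the ideal generated by the discriminant of
`b`. -/
theorem pow_mul_intNorm_mem_relDisc (b : Basis (Fin (finrank K L)) K L) (s : 𝓞 K)
    (hb : ∀ i, IsIntegral ℤ (b i))
    (hs : ∀ y : 𝓞 L, algebraMap (𝓞 K) L s * (y : L) ∈ Submodule.span (𝓞 K) (Set.range b))
    {x : 𝓞 L} (hx : x ∈ differentIdeal (𝓞 K) (𝓞 L)) :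
    s ^ (2 * finrank K L) * Algebra.intNorm (𝓞 K) (𝓞 L) x ∈ relDisc K L := by
  -- Tr(s y bⱼ*) is the j-th coordinate of s y, hence integral.
  have hdual (j) : algebraMap (𝓞 K) L s * b.traceDual j ∈
      Submodule.traceDual (𝓞 K) K (1 : Submodule (𝓞 L) L) := by
    rw [Submodule.mem_traceDual]
    rintro _ ⟨y, rfl⟩
    have h := (b.mem_span_iff_repr_mem (𝓞 K) _).mp (hs y) j
    rw [repr_eq_trace_traceDual] at h
    rw [Algebra.traceForm_apply]
    convert! h using 2
    simp only [LinearMap.toSpanSingleton_apply, Algebra.smul_def, mul_one]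
    ring
  have hx' : (x : L) ∈ (1 / Submodule.traceDual (𝓞 K) K (1 : Submodule (𝓞 L) L)) := by
    rw [← coeSubmodule_differentIdeal (𝓞 K) K (𝓞 L)]
    exact (IsLocalization.mem_coeSubmodule _ _).mpr ⟨x, hx, rfl⟩
  -- One factor s puts bⱼ* into the dual of `𝓞 L`, which x carries into `𝓞 L`; the other returns to
  -- the span of `b`.
  have hmem (j) : algebraMap (𝓞 K) L s ^ 2 * (x : L) * b.traceDual j ∈
      Submodule.span (𝓞 K) (Set.range b) := by
    obtain ⟨y, hy⟩ := Submodule.mem_one.mp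
      (Submodule.mem_div_iff_forall_mul_mem.mp hx' _ (hdual j))
    have := hs y
    rw [show (y : L) = algebraMap (𝓞 L) L y from rfl, hy] at this
    convert! this using 1
    ring
  choose U hU using fun k j ↦ (b.mem_span_iff_repr_mem (𝓞 K) _).mp (hmem j) k
  obtain ⟨d, hd⟩ : ∃ d : 𝓞 K, algebraMap (𝓞 K) K d = Algebra.discr K b :=
    ⟨⟨_, isIntegral_trans (A := 𝓞 K) _
      (Algebra.discr_isIntegral K fun i ↦ (hb i).tower_top)⟩, rfl⟩
  -- Expanding bᵢ in the dual basis has coefficients Tr(bᵢ bⱼ), so multiplication by s² x factors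
  -- through the trace matrix, whose determinant is the discriminant of `b`.
  have hmat : Algebra.leftMulMatrix b (algebraMap (𝓞 K) L s ^ 2 * (x : L)) =
      (algebraMap (𝓞 K) K).mapMatrix (Matrix.of U) * (Algebra.traceMatrix K b).transpose := by
    ext k i
    rw [Algebra.leftMulMatrix_eq_repr_mul]
    conv_lhs => rw [← b.traceDual.sum_repr (b i)]
    simp_rw [Finset.mul_sum, map_sum, Finsupp.coe_finsetSum, Finset.sum_apply, mul_smul_comm,
      map_smul, Finsupp.smul_apply, ← hU, Basis.traceDual_repr_apply]
    simp [Matrix.mul_apply, Algebra.traceMatrix_apply, mul_comm]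
  have hnorm : algebraMap (𝓞 K) K (s ^ (2 * finrank K L) * Algebra.intNorm (𝓞 K) (𝓞 L) x) =
      algebraMap (𝓞 K) K ((Matrix.of U).det * d) := by
    have h := congrArg Matrix.det hmat
    rw [← Algebra.norm_eq_matrix_det, Matrix.det_mul, Matrix.det_transpose, ← RingHom.map_det,
      ← Algebra.discr_def, map_mul, map_pow, IsScalarTower.algebraMap_apply (𝓞 K) K L,
      Algebra.norm_algebraMap, ← pow_mul, mul_comm _ 2] at h
    rw [map_mul, map_mul, Algebra.algebraMap_intNorm (L := L), map_pow, hd]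
    exact h
  rw [FaithfulSMul.algebraMap_injective (𝓞 K) K hnorm]
  exact Ideal.mul_mem_left _ _ (Ideal.subset_span ⟨b, hb, hd⟩)

variable (K L)

theorem relNorm_differentIdeal_le_relDisc :
    Ideal.relNorm (𝓞 K) (differentIdeal (𝓞 K) (𝓞 L)) ≤ relDisc K L := by
  rw [← Ideal.spanNorm_eq, Ideal.spanNorm, Ideal.map, Ideal.span_le]
  rintro _ ⟨x, hx, rfl⟩
  rw [SetLike.mem_coe]
  -- If `J` lay in a maximal ideal `q`, the local basis at `q` would give a power of s in `J`,
  -- although s ∉ `q`.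
  let J : Ideal (𝓞 K) := (relDisc K L).colon {Algebra.intNorm (𝓞 K) (𝓞 L) x}
  suffices J = ⊤ by
    have h : (1 : 𝓞 K) ∈ J := this ▸ Submodule.mem_top
    simpa [J, Submodule.mem_colon_singleton] using h
  by_contra hJ
  obtain ⟨q, hq, hJq⟩ := Ideal.exists_le_maximal J hJ
  obtain ⟨b, s, hsq, hb, hs⟩ := exists_basis_smul_mem_span K L q
  refine hsq (hq.isPrime.mem_of_pow_mem _ (hJq (x := s ^ (2 * finrank K L)) ?_))
  simpa [J, Submodule.mem_colon_singleton] using pow_mul_intNorm_mem_relDisc b s hb hs hx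

theorem relDisc_ne_bot : relDisc K L ≠ ⊥ := by
  intro h
  have := relNorm_differentIdeal_le_relDisc K L
  rw [h, le_bot_iff, Ideal.relNorm_eq_bot_iff] at this
  exact differentIdeal_ne_bot this

/-- Makes the division in the claimed factor genuine; being an integer, the norm is then at least 1,
which gives part 2. -/
theorem absNorm_relDisc_pos : 0 < Ideal.absNorm (relDisc K L) :=
  Nat.pos_of_ne_zero (Ideal.absNorm_eq_zero_iff.not.mpr (relDisc_ne_bot K L))

theorem absNorm_relDisc_mul_le :
    Ideal.absNorm (relDisc K L) * (discr K).natAbs ^ finrank K L ≤ (discr L).natAbs := by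
  rw [natAbs_discr_eq_absNorm_differentIdeal_mul_natAbs_discr_pow K (𝓞 K) L (𝓞 L)]
  refine Nat.mul_le_mul_right _ ?_
  rw [← Ideal.absNorm_relNorm (R := 𝓞 K) (I := differentIdeal (𝓞 K) (𝓞 L))]
  refine Nat.le_of_dvd (Nat.pos_of_ne_zero ?_)
    (Ideal.absNorm_dvd_absNorm_of_le (relNorm_differentIdeal_le_relDisc K L))
  rw [Ne, Ideal.absNorm_eq_zero_iff, Ideal.relNorm_eq_bot_iff]
  exact differentIdeal_ne_bot

end RelDisc

/-! ### Degrees and norms over the decomposition field -/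

section DecompField

variable {L : Type*} [Field L] [NumberField L] [IsGalois ℚ L]

instance isDecompositionField_decompField (P : Ideal (𝓞 L)) :
    IsDecompositionField ℚ L P (decompField L P) :=
  inferInstanceAs (IsDecompositionField ℚ L P
    (FixedPoints.intermediateField (MulAction.stabilizer Gal(L/ℚ) P) : IntermediateField ℚ L))

/-- The Galois group permutes the primes over p transitively, so the decomposition group has index
g. -/
theorem finrank_decompField {p : ℕ} (hp : p.Prime) (P : Ideal (𝓞 L)) [P.IsPrime]
    [P.LiesOver (Ideal.span {(p : ℤ)})] :
    finrank ℚ (decompField L P) = (Ideal.primesOver (Ideal.span {(p : ℤ)}) (𝓞 L)).ncard := by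
  have hp0 : Ideal.span {(p : ℤ)} ≠ ⊥ := by simp [hp.ne_zero]
  have hP0 : P ≠ ⊥ := Ideal.ne_bot_of_liesOver_of_ne_bot hp0 P
  have : P.IsMaximal := Ideal.IsPrime.isMaximal ‹_› hP0
  have : IsGaloisGroup Gal(L/ℚ) ℤ (𝓞 L) := .of_isFractionRing _ _ _ ℚ L
  exact IsDecompositionField.rank_right ℤ ℚ L P (decompField L P) hp0

/-- A prime `P` that is unramified over `ℚ` has degree `[L : K]` over the prime below it in its
decomposition field `K`. -/
theorem absNorm_eq_absNorm_under_decompField_pow {p : ℕ} (hp : p.Prime) (P : Ideal (𝓞 L))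
    [P.IsPrime] [P.LiesOver (Ideal.span {(p : ℤ)})]
    (hunram : Algebra.IsUnramifiedIn (𝓞 L) (Ideal.span {(p : ℤ)})) :
    Ideal.absNorm P = Ideal.absNorm (P.under (𝓞 (decompField L P))) ^
      finrank (decompField L P) L := by
  set K := decompField L P
  have hp0 : Ideal.span {(p : ℤ)} ≠ ⊥ := by simp [hp.ne_zero]
  set c := P.under (𝓞 K)
  have hP0 : P ≠ ⊥ := Ideal.ne_bot_of_liesOver_of_ne_bot hp0 P
  have : P.IsMaximal := Ideal.IsPrime.isMaximal ‹_› hP0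
  have hcm : c.IsMaximal := Ideal.IsMaximal.under (𝓞 K) P
  have hsingle : c.primesOver (𝓞 L) = {P} :=
    IsDecompositionField.primesOver_eq_singleton ℚ L P K (𝓞 K) c
  have he : P.ramificationIdx (𝓞 K) = 1 := by
    have h := Ideal.ramificationIdx_tower (R := ℤ) c P
    rw [hunram.ramificationIdx_eq_one ‹_›] at h
    exact Nat.eq_one_of_mul_eq_one_left h.symm
  let G := MulAction.stabilizer Gal(L/ℚ) P
  have : IsGaloisGroup G (𝓞 K) (𝓞 L) := .of_isFractionRing _ _ _ K L
  -- With one prime over `c` and ramification index 1, the fundamental identity leaves f = [L : K].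
  have hsum := Ideal.ncard_primesOver_mul_ramificationIdxIn_mul_inertiaDegIn c (𝓞 L) G
  rw [hsingle, Set.ncard_singleton, one_mul, Ideal.ramificationIdxIn_eq_ramificationIdx c P G, he,
    one_mul, Ideal.inertiaDegIn_eq_inertiaDeg c P G, IsGaloisGroup.card_eq_finrank G K L] at hsum
  rw [← hsum, Ideal.absNorm_pow_inertiaDeg c P]

end DecompField

/-! ### Comparison of determinants and the main theorem -/

/-- The determinant of the lattice of a prime `P` of degree `[L : K]` over the prime `c` of `K`
below it is at least `√N(disc(L/K)) * det(c) ^ [L : K]`; the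
statement is about the squares. -/
theorem absNorm_relDisc_mul_latticeDet_le {K L : Type*} [Field K] [NumberField K] [Field L]
    [NumberField L] [Algebra K L] {c : Ideal (𝓞 K)} {P : Ideal (𝓞 L)} (hc : c ≠ ⊥) (hP : P ≠ ⊥)
    (h : Ideal.absNorm P = Ideal.absNorm c ^ finrank K L) :
    Ideal.absNorm (relDisc K L) * (latticeDet (idealLattice K c) ^ finrank K L) ^ 2 ≤
      latticeDet (idealLattice L P) ^ 2 := by
  rw [← pow_mul, mul_comm (finrank K L), pow_mul, latticeDet_idealLattice_sq hc,
    latticeDet_idealLattice_sq hP, h, mul_pow, ← mul_assoc]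
  have hle : (Ideal.absNorm (relDisc K L) : ℝ) * |(discr K : ℝ)| ^ finrank K L ≤
      |(discr L : ℝ)| := by
    have := absNorm_relDisc_mul_le K L
    rw [← Int.cast_abs, ← Int.cast_abs, ← Nat.cast_natAbs, ← Nat.cast_natAbs]
    exact_mod_cast this
  refine (mul_le_mul_of_nonneg_right hle (by positivity)).trans_eq ?_
  push_cast
  ring

theorem rpow_absNorm_relDisc_mul_rpow_latticeDet_le {K L : Type*} [Field K] [NumberField K]
    [Field L] [NumberField L] [Algebra K L] {c : Ideal (𝓞 K)} {P : Ideal (𝓞 L)} (hc : c ≠ ⊥)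
    (hP : P ≠ ⊥) (h : Ideal.absNorm P = Ideal.absNorm c ^ finrank K L) :
    (Ideal.absNorm (relDisc K L) : ℝ) ^ (1 / (2 * (finrank ℚ L : ℝ))) *
        latticeDet (idealLattice K c) ^ (1 / (finrank ℚ K : ℝ)) ≤
      latticeDet (idealLattice L P) ^ (1 / (finrank ℚ L : ℝ)) := by
  have hdc := latticeDet_nonneg (idealLattice K c)
  have hdP := latticeDet_nonneg (idealLattice L P)
  have hN : (finrank ℚ L : ℝ) ≠ 0 := Nat.cast_ne_zero.mpr finrank_pos.ne'
  have hK : (finrank ℚ K : ℝ) ≠ 0 := Nat.cast_ne_zero.mpr finrank_pos.ne'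
  have hLK : (finrank K L : ℝ) ≠ 0 := Nat.cast_ne_zero.mpr finrank_pos.ne'
  have hmul : (finrank ℚ L : ℝ) = finrank ℚ K * finrank K L := by
    exact_mod_cast (finrank_mul_finrank ℚ K L).symm
  have := Real.rpow_le_rpow (by positivity) (absNorm_relDisc_mul_latticeDet_le hc hP h)
    (show 0 ≤ 1 / (2 * (finrank ℚ L : ℝ)) by positivity)
  rw [Real.mul_rpow (by positivity) (by positivity), ← pow_mul, ← Real.rpow_natCast,
    ← Real.rpow_natCast, ← Real.rpow_mul hdc, ← Real.rpow_mul hdP] at this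
  rwa [show ((finrank K L * 2 : ℕ) : ℝ) * (1 / (2 * (finrank ℚ L : ℝ))) = 1 / finrank ℚ K by
      rw [hmul]; push_cast; field_simp,
    show ((2 : ℕ) : ℝ) * (1 / (2 * (finrank ℚ L : ℝ))) = 1 / finrank ℚ L by
      push_cast; field_simp] at this

theorem isHermiteSVPSolution_algebraMap {K L : Type*} [Field K] [NumberField K] [Field L]
    [NumberField L] [Algebra K L] {P : Ideal (𝓞 L)} (hc : P.under (𝓞 K) ≠ ⊥) (hP : P ≠ ⊥)
    (h : Ideal.absNorm P = Ideal.absNorm (P.under (𝓞 K)) ^ finrank K L) {γ : ℝ} {x : K}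
    (hx : IsHermiteSVPSolution (idealLattice K (P.under (𝓞 K))) γ (canonEmb K x)) :
    IsHermiteSVPSolution (idealLattice L P)
      (√(finrank K L) / (Ideal.absNorm (relDisc K L) : ℝ) ^ (1 / (2 * (finrank ℚ L : ℝ))) * γ)
      (canonEmb L (algebraMap K L x)) := by
  obtain ⟨hmem, hne, hle⟩ := hx
  refine ⟨?_, ?_, ?_⟩
  · obtain ⟨y, hy, rfl⟩ := canonEmb_mem_idealLattice.mp hmem
    exact canonEmb_mem_idealLattice.mpr ⟨algebraMap (𝓞 K) (𝓞 L) y, hy, rfl⟩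
  · rw [Ne, map_eq_zero_iff _ canonEmb_injective] at hne ⊢
    simpa using hne
  · rw [finrank_idealLattice hc] at hle
    rw [finrank_idealLattice hP]
    set D := latticeDet (idealLattice K (P.under (𝓞 K))) ^ (1 / (finrank ℚ K : ℝ))
    have hD : 0 ≤ D := Real.rpow_nonneg (latticeDet_nonneg _) _
    -- A negative factor would force the nonzero vector to have norm 0.
    have hγ : 0 ≤ γ := by
      by_contra! hneg
      exact hne (norm_le_zero_iff.mp (hle.trans (mul_nonpos_of_nonpos_of_nonneg hneg.le hD)))
    have hnorm : ‖canonEmb L (algebraMap K L x)‖ = √(finrank K L) * ‖canonEmb K x‖ := by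
      rw [← Real.sqrt_sq (norm_nonneg _), norm_canonEmb_algebraMap_sq,
        Real.sqrt_mul (Nat.cast_nonneg _), Real.sqrt_sq (norm_nonneg _)]
    have hd : 0 < (Ideal.absNorm (relDisc K L) : ℝ) ^ (1 / (2 * (finrank ℚ L : ℝ))) :=
      Real.rpow_pos_of_pos (Nat.cast_pos.mpr (absNorm_relDisc_pos K L)) _
    set d := (Ideal.absNorm (relDisc K L) : ℝ) ^ (1 / (2 * (finrank ℚ L : ℝ)))
    have hkey := rpow_absNorm_relDisc_mul_rpow_latticeDet_le hc hP h
    rw [hnorm]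
    calc √(finrank K L) * ‖canonEmb K x‖ ≤ √(finrank K L) * (γ * D) := by gcongr
      _ = √(finrank K L) / d * γ * (d * D) := by field_simp
      _ ≤ _ := by gcongr

theorem mainTheorem4 (L : Type*) [Field L] [NumberField L] [IsGalois ℚ L]
    (N g p : ℕ) (hN : finrank ℚ L = N) (hp : p.Prime)
    (P : Ideal (𝓞 L)) [P.IsPrime] [P.LiesOver (Ideal.span {(p : ℤ)})]
    (hunram : Algebra.IsUnramifiedIn (𝓞 L) (Ideal.span {(p : ℤ)}))
    (hg : (Ideal.primesOver (Ideal.span {(p : ℤ)}) (𝓞 L)).ncard = g)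
    (K : IntermediateField ℚ L) (hK : K = decompField L P)
    (c : Ideal (𝓞 K)) (hc : c = P.under (𝓞 K)) :
    -- a solution in `c` with factor `γ` is a solution in `P` with the claimed factor
    (∀ (γ : ℝ) (x : K), IsHermiteSVPSolution (idealLattice K c) γ (canonEmb K x) →
      IsHermiteSVPSolution (idealLattice L P)
        (√((N : ℝ) / g) / (Ideal.absNorm (relDisc K L) : ℝ) ^ (1 / (2 * (N : ℝ))) * γ)
        (canonEmb L (x : L))) ∧
    -- the claimed factor is at most `√(N / g) * γ`
    (∀ γ : ℝ, 0 ≤ γ →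
      √((N : ℝ) / g) / (Ideal.absNorm (relDisc K L) : ℝ) ^ (1 / (2 * (N : ℝ))) * γ
        ≤ √((N : ℝ) / g) * γ) ∧
    -- for `γ = √g`, which is the Minkowski bound in `c`, the Minkowski bound in `P` results
    (∀ x : K, (IsHermiteSVPSolution (idealLattice K c) √(g : ℝ) (canonEmb K x) ↔
        SatisfiesMinkowskiBound (idealLattice K c) (canonEmb K x)) ∧
      (SatisfiesMinkowskiBound (idealLattice K c) (canonEmb K x) →
        SatisfiesMinkowskiBound (idealLattice L P) (canonEmb L (x : L)))) := by
  subst hc hK hN hg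
  have hp0 : Ideal.span {(p : ℤ)} ≠ ⊥ := by simp [hp.ne_zero]
  have hP0 : P ≠ ⊥ := Ideal.ne_bot_of_liesOver_of_ne_bot hp0 P
  set K := decompField L P
  have hK : finrank ℚ K = _ := finrank_decompField hp P
  rw [← hK]
  have hc0 : P.under (𝓞 K) ≠ ⊥ := by
    have : (P.under (𝓞 K)).LiesOver (Ideal.span {(p : ℤ)}) :=
      Ideal.LiesOver.tower_bot P (P.under (𝓞 K)) _
    exact Ideal.ne_bot_of_liesOver_of_ne_bot hp0 _
  have hratio : (finrank ℚ L : ℝ) / finrank ℚ K = finrank K L := by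
    rw [← finrank_mul_finrank ℚ K L, Nat.cast_mul, mul_div_cancel_left₀]
    exact Nat.cast_ne_zero.mpr finrank_pos.ne'
  rw [hratio]
  have hsol {γ : ℝ} {x : K} := isHermiteSVPSolution_algebraMap (γ := γ) (x := x) hc0 hP0
    (absNorm_eq_absNorm_under_decompField_pow hp P hunram)
  have hfactor {γ : ℝ} (hγ : 0 ≤ γ) :
      √(finrank K L) / (Ideal.absNorm (relDisc K L) : ℝ) ^ (1 / (2 * (finrank ℚ L : ℝ))) * γ ≤
        √(finrank K L) * γ := by
    gcongr
    refine div_le_self (Real.sqrt_nonneg _) (Real.one_le_rpow ?_ (by positivity))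
    exact_mod_cast absNorm_relDisc_pos K L
  refine ⟨fun γ x ↦ hsol, fun γ ↦ hfactor, fun x ↦ ?_⟩
  have hiff : IsHermiteSVPSolution (idealLattice K (P.under (𝓞 K))) √(finrank ℚ K)
      (canonEmb K x) ↔ SatisfiesMinkowskiBound (idealLattice K (P.under (𝓞 K))) (canonEmb K x) := by
    rw [IsHermiteSVPSolution, SatisfiesMinkowskiBound, finrank_idealLattice hc0]
  refine ⟨hiff, fun hx ↦ ?_⟩
  obtain ⟨hmem, hne, hle⟩ := hsol (hiff.mpr hx)
  refine ⟨hmem, hne, hle.trans (mul_le_mul_of_nonneg_right ?_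
    (Real.rpow_nonneg (latticeDet_nonneg _) _))⟩
  -- √[L : K] · √[K : ℚ] = √[L : ℚ].
  refine (hfactor (Real.sqrt_nonneg _)).trans_eq ?_
  rw [finrank_idealLattice hP0, ← Real.sqrt_mul (Nat.cast_nonneg _), ← Nat.cast_mul, mul_comm,
    finrank_mul_finrank]
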